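/- For a nonzero polynomial $f\in\mathbb{C}[z]$ let $$M(f)=\exp\left(\int_0^1\log|f(e^{2\pi i t})|\,dt\right)$$ denote its Mahler measure, and let $h(f)$ denote its height, that is, the maximum modulus of its coefficients. Let $k\ge 2$ be an integer, let $n_1>n_2>\cdots>n_{k-1}>0$ be integers, and let $a_1,\dots,a_k\in\mathbb{C}$ (some of which may be $0$) be such that $$f(z)=a_1z^{n_1}+\cdots+a_{k-1}z^{n_{k-1}}+a_k$$ is a nonzero polynomial. Then $$M(f)\ge \frac{h(f)}{2^{k-2}}.$$ -/

import Mathlib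

namespace Polynomial

open ComplexConjugate

/-! Induction on the number of terms, one factor 2 per term. Dividing by powers of `X` changes
neither M nor the nonzero coefficients, so p(0) ≠ 0 may be assumed. With n = deg p, both p' and np -
zp' have fewer terms than p, they multiply the i-th coefficient by i and by n - i, and one of these
is at least n/2. Hence it suffices that both have Mahler measure at most n M(p).

For these two bounds, reflect the roots of a monic P of degree n into the closed disc. The product Q
so obtained satisfies |Q| = |P| on the unit circle, and there |Q'| dominates both |P'| and |nP -
zP'|. By Gauss–Lucas the roots of Q' stay in the disc, so M(Q') is the modulus of its leading
coefficient, which is deg Q · M(Q). -/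

/-! ### Reflection of roots into the closed unit disc -/

/-- The linear polynomial with root `α` if `α` lies in the closed unit disc, and otherwise a linear
polynomial with root `1 / conj α`; its modulus on the unit circle is that of `X - α`. -/
noncomputable def reflectedFactor (α : ℂ) : ℂ[X] :=
  if ‖α‖ ≤ 1 then X - C α else C (conj α) * X + C (-1)

/-- The product of the reflected factors of a multiset of points. -/
noncomputable def reflectedProd (s : Multiset ℂ) : ℂ[X] := (s.map reflectedFactor).prod

lemma mahlerMeasure_reflectedFactor (α : ℂ) :
    (reflectedFactor α).mahlerMeasure = max 1 ‖α‖ := by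
  unfold reflectedFactor
  split_ifs with h
  · exact mahlerMeasure_X_sub_C α
  · have hα : conj α ≠ 0 := by
      rw [_root_.map_ne_zero]
      rintro rfl
      simp at h
    rw [mahlerMeasure_C_mul_X_add_C hα]
    simp [max_comm]

lemma mahlerMeasure_reflectedProd (s : Multiset ℂ) :
    (reflectedProd s).mahlerMeasure = (s.map fun α ↦ X - C α).prod.mahlerMeasure := by
  simp only [reflectedProd, prod_mahlerMeasure_eq_mahlerMeasure_prod, Multiset.map_map,
    Function.comp_def, mahlerMeasure_reflectedFactor, mahlerMeasure_X_sub_C]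

lemma norm_le_one_of_eval_reflectedFactor {α z : ℂ} (h : (reflectedFactor α).eval z = 0) :
    ‖z‖ ≤ 1 := by
  unfold reflectedFactor at h
  split_ifs at h with hα
  · rw [eval_sub, eval_X, eval_C, sub_eq_zero] at h
    rwa [h]
  · have h1 : conj α * z = 1 := by
      simpa [add_neg_eq_zero] using h
    have h2 := congrArg norm h1
    rw [norm_mul, RCLike.norm_conj, norm_one] at h2
    nlinarith [norm_nonneg z]

lemma norm_le_one_of_eval_reflectedProd {s : Multiset ℂ} {z : ℂ}
    (h : (reflectedProd s).eval z = 0) : ‖z‖ ≤ 1 := by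
  rw [reflectedProd, eval_multiset_prod, Multiset.map_map, Multiset.prod_eq_zero_iff] at h
  obtain ⟨α, -, hα⟩ := Multiset.mem_map.1 h
  exact norm_le_one_of_eval_reflectedFactor hα

lemma natDegree_reflectedFactor_le (α : ℂ) : (reflectedFactor α).natDegree ≤ 1 := by
  unfold reflectedFactor
  split_ifs
  · exact (natDegree_X_sub_C α).le
  · exact natDegree_linear_le

lemma natDegree_reflectedProd_le (s : Multiset ℂ) : (reflectedProd s).natDegree ≤ s.card := by
  refine (natDegree_multiset_prod_le _).trans ?_
  rw [Multiset.map_map]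
  simpa using Multiset.sum_le_card_nsmul (s.map (natDegree ∘ reflectedFactor)) 1 (by
    intro x hx
    obtain ⟨α, -, rfl⟩ := Multiset.mem_map.1 hx
    exact natDegree_reflectedFactor_le α)

/-! ### Logarithmic derivatives on the unit circle -/

/-- The relation between the logarithmic derivatives `w`, `u` at a point of the unit circle of a
product of `m` linear factors and of the product of the reflected factors. -/
structure LogDerivRel (m : ℕ) (w u : ℂ) : Prop where
  im_eq : u.im = w.im
  re_le : w.re ≤ u.re
  neg_re_le : -w.re ≤ u.re
  sub_re_le : m - w.re ≤ u.re
  re_sub_le : w.re - m ≤ u.re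

lemma LogDerivRel.add {m m' : ℕ} {w u w' u' : ℂ} (h : LogDerivRel m w u)
    (h' : LogDerivRel m' w' u') : LogDerivRel (m + m') (w + w') (u + u') := by
  obtain ⟨h1, h2, h3, h4, h5⟩ := h
  obtain ⟨k1, k2, k3, k4, k5⟩ := h'
  constructor <;> push_cast <;> simp only [Complex.add_re, Complex.add_im] <;> linarith

lemma LogDerivRel.norm_le {m : ℕ} {w u : ℂ} (h : LogDerivRel m w u) : ‖w‖ ≤ ‖u‖ := by
  obtain ⟨h1, h2, h3, -, -⟩ := h
  rw [← sq_le_sq₀ (norm_nonneg _) (norm_nonneg _), Complex.sq_norm, Complex.sq_norm,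
    Complex.normSq_apply, Complex.normSq_apply, h1]
  nlinarith

lemma LogDerivRel.norm_sub_le {m : ℕ} {w u : ℂ} (h : LogDerivRel m w u) : ‖m - w‖ ≤ ‖u‖ := by
  obtain ⟨h1, -, -, h2, h3⟩ := h
  rw [← sq_le_sq₀ (norm_nonneg _) (norm_nonneg _), Complex.sq_norm, Complex.sq_norm,
    Complex.normSq_apply, Complex.normSq_apply, h1]
  simp only [Complex.sub_re, Complex.sub_im, Complex.natCast_re, Complex.natCast_im]
  nlinarith

/-- Here w = z/(z - α), and 1 - w = -α/(z - α). Comparing |α| with |z| = 1 decides on which side of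
1/2 the real part of w lies. Reflection replaces w by u = 1 - conj w when |α| > 1, so Re u is always
the larger of Re w and 1 - Re w. -/
lemma exists_logDerivRel_reflectedFactor {α z : ℂ} (hz : ‖z‖ = 1) (hzα : z - α ≠ 0) :
    ∃ w u : ℂ, z = w * (z - α) ∧
      z * (reflectedFactor α).derivative.eval z = u * (reflectedFactor α).eval z ∧
      ‖z - α‖ = ‖(reflectedFactor α).eval z‖ ∧ LogDerivRel 1 w u := by
  obtain ⟨w, hw⟩ : ∃ w, z = w * (z - α) := ⟨z / (z - α), by field_simp⟩
  have hw' : (1 - w) * (z - α) = -α := by linear_combination hw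
  have hd : 0 < ‖z - α‖ := norm_pos_iff.2 hzα
  have n1 : ‖w‖ * ‖z - α‖ = 1 := by rw [← norm_mul, ← hw, hz]
  have n2 : ‖1 - w‖ * ‖z - α‖ = ‖α‖ := by rw [← norm_mul, hw', norm_neg]
  have s1 : ‖w‖ ^ 2 = w.re ^ 2 + w.im ^ 2 := by
    rw [Complex.sq_norm, Complex.normSq_apply]; ring
  have s2 : ‖1 - w‖ ^ 2 = (1 - w.re) ^ 2 + w.im ^ 2 := by
    rw [Complex.sq_norm, Complex.normSq_apply]; simp; ring
  have hzz : z * conj z = 1 := by rw [Complex.mul_conj, Complex.normSq_eq_norm_sq, hz]; simp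
  unfold reflectedFactor
  split_ifs with h
  · have hle : ‖1 - w‖ ≤ ‖w‖ := le_of_mul_le_mul_right (by linarith) hd
    have hre : 1 / 2 ≤ w.re := by
      nlinarith [norm_nonneg (1 - w), pow_le_pow_left₀ (norm_nonneg (1 - w)) hle 2]
    refine ⟨w, w, hw, by simpa using hw, by simp, ?_⟩
    constructor <;> push_cast <;> linarith
  · have hle : ‖w‖ ≤ ‖1 - w‖ := le_of_mul_le_mul_right (by linarith) hd
    have hre : w.re ≤ 1 / 2 := by
      nlinarith [norm_nonneg w, pow_le_pow_left₀ (norm_nonneg w) hle 2]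
    refine ⟨w, 1 - conj w, hw, ?_, ?_, ?_⟩
    · have hc := congrArg conj hw'
      simp only [map_mul, map_sub, map_one, map_neg] at hc
      simp only [derivative_add, derivative_mul, derivative_C, derivative_X, eval_add, eval_mul,
        eval_C, eval_X, eval_zero, eval_one]
      linear_combination z * hc - (1 - conj w) * hzz
    · have : conj α * z + -1 = -(z * conj (z - α)) := by
        rw [map_sub]; linear_combination hzz
      simp only [eval_add, eval_mul, eval_C, eval_X]
      rw [this, norm_neg, norm_mul, hz, RCLike.norm_conj, one_mul]
    · constructor <;> simp <;> linarith

lemma exists_logDerivRel_reflectedProd {z : ℂ} (hz : ‖z‖ = 1) (s : Multiset ℂ)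
    (hs : (s.map fun α ↦ X - C α).prod.eval z ≠ 0) :
    ∃ w u : ℂ, z * (s.map fun α ↦ X - C α).prod.derivative.eval z =
        w * (s.map fun α ↦ X - C α).prod.eval z ∧
      z * (reflectedProd s).derivative.eval z = u * (reflectedProd s).eval z ∧
      ‖(s.map fun α ↦ X - C α).prod.eval z‖ = ‖(reflectedProd s).eval z‖ ∧
      LogDerivRel s.card w u := by
  induction s using Multiset.induction_on with
  | empty => exact ⟨0, 0, by simp, by simp [reflectedProd], by simp [reflectedProd],
      by constructor <;> simp⟩
  | cons α s ih =>
    rw [Multiset.map_cons, Multiset.prod_cons, eval_mul, eval_sub, eval_X, eval_C] at hs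
    obtain ⟨w, u, h1, h2, h3, h4⟩ := ih (right_ne_zero_of_mul hs)
    obtain ⟨w', u', k1, k2, k3, k4⟩ :=
      exists_logDerivRel_reflectedFactor hz (left_ne_zero_of_mul hs)
    have hr : reflectedProd (α ::ₘ s) = reflectedFactor α * reflectedProd s := by
      simp [reflectedProd]
    refine ⟨w + w', u + u', ?_, ?_, ?_, ?_⟩
    · simp only [Multiset.map_cons, Multiset.prod_cons, derivative_mul, derivative_sub,
        derivative_X, derivative_C, eval_add, eval_mul, eval_sub, eval_X, eval_C, eval_one,
        eval_zero]
      linear_combination (z - α) * h1 + (s.map fun α ↦ X - C α).prod.eval z * k1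
    · rw [hr, derivative_mul, eval_add, eval_mul, eval_mul, eval_mul]
      linear_combination (reflectedFactor α).eval z * h2 + (reflectedProd s).eval z * k2
    · rw [hr, Multiset.map_cons, Multiset.prod_cons, eval_mul, eval_mul, norm_mul, norm_mul, h3,
        ← k3, eval_sub, eval_X, eval_C]
    · rw [Multiset.card_cons]
      exact h4.add k4

/-! ### Mahler's inequality for the derivative and its mirror image -/

/-- Comparison of Mahler measures of polynomials whose moduli compare on the unit circle outside
the roots of a nonzero polynomial. -/
lemma mahlerMeasure_le_of_norm_eval_le {p q r : ℂ[X]} (hr : r ≠ 0)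
    (h : ∀ z : ℂ, ‖z‖ = 1 → r.eval z ≠ 0 → ‖p.eval z‖ ≤ ‖q.eval z‖) :
    p.mahlerMeasure ≤ q.mahlerMeasure := by
  classical
  by_cases hp : p = 0
  · rw [hp, mahlerMeasure_zero]
    exact q.mahlerMeasure_nonneg
  -- If q were 0, then r * p would vanish on the whole circle, an infinite set.
  have hq : q ≠ 0 := by
    rintro rfl
    refine mul_ne_zero hr hp (eq_zero_of_infinite_isRoot _ ?_)
    refine Set.Infinite.mono (s := Metric.sphere (0 : ℂ) 1) (fun z hz ↦ ?_) ?_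
    · by_cases hrz : r.eval z = 0
      · simp [IsRoot, hrz]
      · have := h z (by simpa using hz) hrz
        rw [eval_zero, norm_zero] at this
        simp [IsRoot, norm_le_zero_iff.1 this]
    · exact (isPreconnected_sphere (by simp [Complex.rank_real_complex]) 0 1).infinite_of_nontrivial
        ⟨1, by simp, -1, by simp, by norm_num⟩
  rw [mahlerMeasure_def_of_ne_zero hp, mahlerMeasure_def_of_ne_zero hq, Real.exp_le_exp]
  change Real.circleAverage (fun z ↦ Real.log ‖p.eval z‖) 0 1 ≤
    Real.circleAverage (fun z ↦ Real.log ‖q.eval z‖) 0 1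
  -- Since `Real.log 0 = 0`, the logarithms need not compare at zeros of p. Changing the integrand
  -- on the finite zero set of r * p keeps the average and makes the comparison hold everywhere.
  set F : ℂ → ℝ := fun z ↦
    if (r * p).eval z = 0 then Real.log ‖q.eval z‖ else Real.log ‖p.eval z‖ with hF
  have hint (p : ℂ[X]) : CircleIntegrable (fun z ↦ Real.log ‖p.eval z‖) 0 1 :=
    (circleIntegrable_def _ _ _).2 p.intervalIntegrable_mahlerMeasure
  have hfin : {z : ℂ | (r * p).eval z = 0}.Finite :=
    (r * p).roots.finite_toSet.subset fun z hz ↦ by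
      simpa [mem_roots (mul_ne_zero hr hp), -mem_roots'] using hz
  have hcongr : (fun z ↦ Real.log ‖p.eval z‖) =ᶠ[Filter.codiscreteWithin
      (Metric.sphere (0 : ℂ) |1|)] F := by
    filter_upwards [compl_finite_mem_codiscreteWithin hfin] with z hz
    exact (if_neg hz).symm
  rw [Real.circleAverage_congr_codiscreteWithin hcongr one_ne_zero]
  refine Real.circleAverage_mono ((hint p).congr_codiscreteWithin hcongr) (hint q) fun z hz ↦ ?_
  simp only [hF]
  split_ifs with h0
  · rfl
  · rw [eval_mul, mul_eq_zero, not_or] at h0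
    exact Real.log_le_log (norm_pos_iff.2 h0.2) (h z (by simpa using hz) h0.1)

lemma mahlerMeasure_eq_norm_leadingCoeff {p : ℂ[X]} (h : ∀ z ∈ p.roots, ‖z‖ ≤ 1) :
    p.mahlerMeasure = ‖p.leadingCoeff‖ := by
  rw [mahlerMeasure_eq_leadingCoeff_mul_prod_roots, Multiset.map_congr rfl
    fun z hz ↦ max_eq_left (h z hz)]
  simp

/-- If all roots of `p` lie in the closed unit disc, then `M(p') = deg p * M(p)`. -/
lemma mahlerMeasure_derivative_of_roots_norm_le_one {p : ℂ[X]} (h : ∀ z ∈ p.roots, ‖z‖ ≤ 1) :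
    p.derivative.mahlerMeasure = p.natDegree * p.mahlerMeasure := by
  rcases Nat.eq_zero_or_pos p.natDegree with h0 | h0
  · rw [h0, derivative_of_natDegree_zero h0]
    simp
  have hroots : ∀ z ∈ p.derivative.roots, ‖z‖ ≤ 1 := by
    intro z hz
    -- Gauss–Lucas, combined with the convexity of the disc.
    have hsub := rootSet_derivative_subset_convexHull_rootSet (natDegree_pos_iff_degree_pos.1 h0)
    have hball : p.rootSet ℂ ⊆ Metric.closedBall (0 : ℂ) 1 := by
      intro y hy
      rw [mem_closedBall_zero_iff]
      refine h y ?_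
      rw [mem_rootSet] at hy
      exact (mem_roots hy.1).2 (by simpa [IsRoot] using hy.2)
    have := convexHull_min hball (convex_closedBall (0 : ℂ) 1) (hsub (a := z) (by
      rw [mem_roots'] at hz
      exact mem_rootSet.2 ⟨hz.1, by simpa [IsRoot] using hz.2⟩))
    simpa using this
  rw [mahlerMeasure_eq_norm_leadingCoeff h, mahlerMeasure_eq_norm_leadingCoeff hroots,
    leadingCoeff_derivative]
  simp [mul_comm]

lemma mahlerMeasure_derivative_reflectedProd_le (s : Multiset ℂ) :
    (reflectedProd s).derivative.mahlerMeasure ≤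
      s.card * (s.map fun α ↦ X - C α).prod.mahlerMeasure := by
  rw [mahlerMeasure_derivative_of_roots_norm_le_one fun z hz ↦
    norm_le_one_of_eval_reflectedProd (isRoot_of_mem_roots hz), mahlerMeasure_reflectedProd]
  gcongr
  · exact mahlerMeasure_nonneg _
  · exact natDegree_reflectedProd_le s

/-- On the circle zP' = wP and mP - zP' = (m - w)P, where m is the size of s; both |w| and |m - w|
are at most |u|. -/
lemma mahlerMeasure_derivative_prod_X_sub_C_le (s : Multiset ℂ) {P : ℂ[X]}
    (hP : P = (s.map fun α ↦ X - C α).prod) :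
    P.derivative.mahlerMeasure ≤ s.card * P.mahlerMeasure ∧
      (C (s.card : ℂ) * P - X * P.derivative).mahlerMeasure ≤ s.card * P.mahlerMeasure := by
  have hmonic : P.Monic := hP ▸ monic_multiset_prod_of_monic _ _ fun α _ ↦ monic_X_sub_C α
  have key : ∀ z : ℂ, ‖z‖ = 1 → P.eval z ≠ 0 →
      ‖P.derivative.eval z‖ ≤ ‖(reflectedProd s).derivative.eval z‖ ∧
      ‖(C (s.card : ℂ) * P - X * P.derivative).eval z‖ ≤
        ‖(reflectedProd s).derivative.eval z‖ := by
    intro z hz hPz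
    obtain ⟨w, u, h1, h2, h3, h4⟩ := exists_logDerivRel_reflectedProd hz s (hP ▸ hPz)
    rw [← hP] at h1 h3
    have e1 : ‖P.derivative.eval z‖ = ‖w‖ * ‖P.eval z‖ := by
      rw [← norm_mul, ← h1, norm_mul, hz, one_mul]
    have e2 : ‖(reflectedProd s).derivative.eval z‖ = ‖u‖ * ‖P.eval z‖ := by
      rw [h3, ← norm_mul, ← h2, norm_mul, hz, one_mul]
    have e3 : ‖(C (s.card : ℂ) * P - X * P.derivative).eval z‖ = ‖s.card - w‖ * ‖P.eval z‖ := by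
      rw [← norm_mul, sub_mul, eval_sub, eval_mul, eval_mul, eval_C, eval_X, h1]
    rw [e1, e2, e3]
    exact ⟨by gcongr; exact h4.norm_le, by gcongr; exact h4.norm_sub_le⟩
  have hle := hP ▸ mahlerMeasure_derivative_reflectedProd_le s
  exact ⟨(mahlerMeasure_le_of_norm_eval_le hmonic.ne_zero
      fun z hz hPz ↦ (key z hz hPz).1).trans hle,
    (mahlerMeasure_le_of_norm_eval_le hmonic.ne_zero
      fun z hz hPz ↦ (key z hz hPz).2).trans hle⟩

/-- Mahler's inequality `M(p') ≤ deg p * M(p)`. -/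
theorem mahlerMeasure_derivative_le (p : ℂ[X]) :
    p.derivative.mahlerMeasure ≤ p.natDegree * p.mahlerMeasure := by
  set P := (p.roots.map fun α ↦ X - C α).prod with hP
  have hp : p = C p.leadingCoeff * P := (IsAlgClosed.splits p).eq_prod_roots
  rw [(IsAlgClosed.splits p).natDegree_eq_card_roots]
  have h := mul_le_mul_of_nonneg_left (mahlerMeasure_derivative_prod_X_sub_C_le p.roots hP).1
    (norm_nonneg p.leadingCoeff)
  have e1 : p.mahlerMeasure = ‖p.leadingCoeff‖ * P.mahlerMeasure := by
    rw [← mahlerMeasure_const, ← mahlerMeasure_mul, ← hp]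
  have e2 : p.derivative.mahlerMeasure = ‖p.leadingCoeff‖ * P.derivative.mahlerMeasure := by
    rw [← mahlerMeasure_const, ← mahlerMeasure_mul, ← derivative_C_mul, ← hp]
  rw [e1, e2]
  linarith

/-- Mahler's inequality for the reversed polynomial. -/
theorem mahlerMeasure_natDegree_mul_sub_X_mul_derivative_le (p : ℂ[X]) :
    (C (p.natDegree : ℂ) * p - X * p.derivative).mahlerMeasure ≤
      p.natDegree * p.mahlerMeasure := by
  set P := (p.roots.map fun α ↦ X - C α).prod with hP
  have hp : p = C p.leadingCoeff * P := (IsAlgClosed.splits p).eq_prod_roots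
  rw [(IsAlgClosed.splits p).natDegree_eq_card_roots]
  have h := mul_le_mul_of_nonneg_left (mahlerMeasure_derivative_prod_X_sub_C_le p.roots hP).2
    (norm_nonneg p.leadingCoeff)
  have e1 : p.mahlerMeasure = ‖p.leadingCoeff‖ * P.mahlerMeasure := by
    rw [← mahlerMeasure_const, ← mahlerMeasure_mul, ← hp]
  have e2 : (C (p.roots.card : ℂ) * p - X * p.derivative).mahlerMeasure = ‖p.leadingCoeff‖ *
      (C (p.roots.card : ℂ) * P - X * P.derivative).mahlerMeasure := by
    have hd : p.derivative = C p.leadingCoeff * P.derivative := by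
      rw [← derivative_C_mul, ← hp]
    rw [← mahlerMeasure_const, ← mahlerMeasure_mul]
    congr 1
    linear_combination C (p.roots.card : ℂ) * hp - X * hd
  rw [e1, e2]
  linarith

/-! ### Counting terms and bounding coefficients -/

lemma mahlerMeasure_X : (X : ℂ[X]).mahlerMeasure = 1 := by
  simpa using mahlerMeasure_X_sub_C 0

lemma norm_coeff_zero_le_mahlerMeasure (p : ℂ[X]) : ‖p.coeff 0‖ ≤ p.mahlerMeasure := by
  simpa using norm_coeff_le_choose_mul_mahlerMeasure 0 p

lemma card_support_le_card_support_mul_X (p : ℂ[X]) :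
    p.support.card ≤ (p * X).support.card :=
  Finset.card_le_card_of_injOn (· + 1) (fun i hi ↦ by simpa using hi)
    (add_left_injective 1).injOn

lemma card_support_derivative_lt {p : ℂ[X]} (hp : p.coeff 0 ≠ 0) :
    p.derivative.support.card < p.support.card := by
  refine lt_of_le_of_lt (Finset.card_le_card_of_injOn (t := p.support.erase 0) (· + 1) ?_
    (add_left_injective 1).injOn) (Finset.card_erase_lt_of_mem (mem_support_iff.2 hp))
  intro i hi
  have := mem_support_iff.1 (Finset.mem_coe.1 hi)
  rw [coeff_derivative] at this
  simpa using left_ne_zero_of_mul this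

lemma coeff_natDegree_mul_sub_X_mul_derivative (p : ℂ[X]) (i : ℕ) :
    (C (p.natDegree : ℂ) * p - X * p.derivative).coeff i = (p.natDegree - i) * p.coeff i := by
  cases i with
  | zero => simp
  | succ i =>
    rw [coeff_sub, coeff_C_mul, coeff_X_mul, coeff_derivative]
    push_cast
    ring

lemma card_support_natDegree_mul_sub_X_mul_derivative_lt {p : ℂ[X]} (hp : p ≠ 0) :
    (C (p.natDegree : ℂ) * p - X * p.derivative).support.card < p.support.card := by
  refine lt_of_le_of_lt (Finset.card_le_card (t := p.support.erase p.natDegree) fun i hi ↦ ?_)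
    (Finset.card_erase_lt_of_mem (natDegree_mem_support_of_nonzero hp))
  rw [mem_support_iff, coeff_natDegree_mul_sub_X_mul_derivative] at hi
  refine Finset.mem_erase.2 ⟨?_, mem_support_iff.2 (right_ne_zero_of_mul hi)⟩
  rintro rfl
  simp at hi

/-- The coefficients of a polynomial with at most two terms are bounded by its Mahler measure. -/
lemma norm_coeff_le_mahlerMeasure_of_card_support_le_two (p : ℂ[X]) (hp : p.support.card ≤ 2)
    (i : ℕ) : ‖p.coeff i‖ ≤ p.mahlerMeasure := by
  -- Horner induction strips factors `X` until the constant term is nonzero.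
  induction p using recOnHorner generalizing i with
  | M0 => simp
  | MX p _ ih =>
    rw [mahlerMeasure_mul, mahlerMeasure_X, mul_one]
    cases i with
    | zero => simpa using p.mahlerMeasure_nonneg
    | succ i =>
      rw [coeff_mul_X]
      exact ih ((card_support_le_card_support_mul_X p).trans hp) i
  | MC q a hq ha _ =>
    set p := q + C a
    have hp0 : p.coeff 0 ≠ 0 := by simpa [p, hq] using ha
    rcases eq_or_ne (p.coeff i) 0 with hi | hi
    · rw [hi, norm_zero]
      exact p.mahlerMeasure_nonneg
    rcases eq_or_ne i 0 with rfl | hi0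
    · exact norm_coeff_zero_le_mahlerMeasure p
    rcases eq_or_ne i p.natDegree with rfl | hin
    · exact leadingCoeff_le_mahlerMeasure p
    have hn : p.natDegree ≠ 0 := by
      have := le_natDegree_of_ne_zero hi
      omega
    -- A nonzero coefficient strictly between the extreme ones would be a third term.
    have hsub : {0, i, p.natDegree} ⊆ p.support := by
      intro j hj
      simp only [Finset.mem_insert, Finset.mem_singleton] at hj
      rcases hj with rfl | rfl | rfl
      · exact mem_support_iff.2 hp0
      · exact mem_support_iff.2 hi
      · exact natDegree_mem_support_of_nonzero fun h ↦ hp0 (by rw [h, coeff_zero])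
    have := Finset.card_le_card hsub
    rw [Finset.card_eq_three.2 ⟨0, i, p.natDegree, hi0.symm, hn.symm, hin, rfl⟩] at this
    omega

/-- The coefficients of a polynomial with at most `m + 2` terms are bounded by `2 ^ m` times its
Mahler measure. -/
theorem norm_coeff_le_two_pow_mul_mahlerMeasure (m : ℕ) (p : ℂ[X])
    (hp : p.support.card ≤ m + 2) (i : ℕ) : ‖p.coeff i‖ ≤ 2 ^ m * p.mahlerMeasure := by
  induction m generalizing p i with
  | zero => simpa using norm_coeff_le_mahlerMeasure_of_card_support_le_two p hp i
  | succ m ihm =>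
    induction p using recOnHorner generalizing i with
    | M0 => simp
    | MX p _ ih =>
      rw [mahlerMeasure_mul, mahlerMeasure_X, mul_one]
      cases i with
      | zero =>
        rw [coeff_mul_X_zero, norm_zero]
        exact mul_nonneg (by positivity) p.mahlerMeasure_nonneg
      | succ i =>
        rw [coeff_mul_X]
        exact ih ((card_support_le_card_support_mul_X p).trans hp) i
    | MC q a hq ha _ =>
      set p := q + C a
      have hp0 : p.coeff 0 ≠ 0 := by simpa [p, hq] using ha
      have hM := p.mahlerMeasure_nonneg
      rcases eq_or_ne (p.coeff i) 0 with hi | hi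
      · rw [hi, norm_zero]
        exact mul_nonneg (by positivity) hM
      have hin := le_natDegree_of_ne_zero hi
      rcases i with _ | i
      · exact (norm_coeff_zero_le_mahlerMeasure p).trans
          (le_mul_of_one_le_left hM (one_le_pow₀ one_le_two))
      have hn : (0 : ℝ) < p.natDegree := by
        exact_mod_cast (by omega : 0 < p.natDegree)
      refine le_of_mul_le_mul_left ?_ hn
      have hi0 := norm_nonneg (p.coeff (i + 1))
      -- In the upper half the derivative multiplies the coefficient by i + 1 ≥ n/2; in the lower
      -- half its mirror image multiplies it by n - (i + 1) ≥ n/2.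
      rcases le_total p.natDegree (2 * (i + 1)) with hle | hle
      · have h1 := ihm p.derivative (by have := card_support_derivative_lt hp0; omega) i
        have h2 := mul_le_mul_of_nonneg_left (mahlerMeasure_derivative_le p)
          (by positivity : (0 : ℝ) ≤ 2 ^ m)
        have h3 : ‖p.derivative.coeff i‖ = (i + 1) * ‖p.coeff (i + 1)‖ := by
          rw [coeff_derivative, norm_mul, mul_comm]
          congr 1
          exact_mod_cast Complex.norm_natCast (i + 1)
        have h4 : (p.natDegree : ℝ) ≤ 2 * (i + 1) := by exact_mod_cast hle
        have h5 := mul_le_mul_of_nonneg_right h4 hi0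
        rw [h3] at h1
        rw [pow_succ]
        linarith
      · have h1 := ihm (C (p.natDegree : ℂ) * p - X * p.derivative) (by
          have := card_support_natDegree_mul_sub_X_mul_derivative_lt
            (p := p) fun h ↦ hp0 (by rw [h, coeff_zero])
          omega) (i + 1)
        have h2 := mul_le_mul_of_nonneg_left
          (mahlerMeasure_natDegree_mul_sub_X_mul_derivative_le p)
          (by positivity : (0 : ℝ) ≤ 2 ^ m)
        rw [coeff_natDegree_mul_sub_X_mul_derivative, norm_mul, ← Nat.cast_sub hin,
          Complex.norm_natCast, Nat.cast_sub hin] at h1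
        have h4 : 2 * ((i + 1 : ℕ) : ℝ) ≤ p.natDegree := by exact_mod_cast hle
        have h5 := mul_le_mul_of_nonneg_right h4 hi0
        rw [pow_succ]
        linarith

/-- The height of a polynomial with at most `m + 2` terms is at most `2 ^ m` times its Mahler
measure. -/
theorem supNorm_le_two_pow_mul_mahlerMeasure (m : ℕ) (p : ℂ[X])
    (hp : p.support.card ≤ m + 2) : p.supNorm ≤ 2 ^ m * p.mahlerMeasure := by
  obtain ⟨i, hi⟩ := p.exists_eq_supNorm
  rw [hi]
  exact norm_coeff_le_two_pow_mul_mahlerMeasure m p hp i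

end Polynomial

/-- A nonzero complex polynomial `f = a₁ z^{n₁} + ⋯ + a_{k-1} z^{n_{k-1}} + a_k` with `k ≥ 2` and
`n₁ > ⋯ > n_{k-1} > 0` (some `aᵢ` may vanish) satisfies `M(f) ≥ h(f) / 2^{k-2}`.
`Polynomial.mahlerMeasure` is `M(f)`; `Polynomial.supNorm` is the height `h(f)`, the maximum
modulus of the coefficients. -/
theorem theorem1 (k : ℕ) (hk : 2 ≤ k) (a : ℕ → ℂ) (n : ℕ → ℕ)
    (hn : StrictAntiOn n (Set.Icc 1 (k - 1)))
    (hpos : ∀ i ∈ Set.Icc 1 (k - 1), 0 < n i)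
    (f : Polynomial ℂ)
    (hf : f = (∑ i ∈ Finset.Icc 1 (k - 1), Polynomial.C (a i) * Polynomial.X ^ n i)
      + Polynomial.C (a k))
    (hf0 : f ≠ 0) :
    f.mahlerMeasure ≥ f.supNorm / 2 ^ (k - 2) := by
  have hcard : f.support.card ≤ k - 2 + 2 := by
    have hsub : f.support ⊆ insert 0 ((Finset.Icc 1 (k - 1)).image n) := by
      intro i hi
      by_contra hni
      simp only [Finset.mem_insert, Finset.mem_image, not_or, not_exists, not_and] at hni
      refine Polynomial.mem_support_iff.1 hi ?_
      rw [hf, Polynomial.coeff_add, Polynomial.finsetSum_coeff, Polynomial.coeff_C, if_neg hni.1,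
        add_zero]
      refine Finset.sum_eq_zero fun j hj ↦ ?_
      rw [Polynomial.coeff_C_mul_X_pow, if_neg fun h ↦ hni.2 j hj h.symm]
    refine (Finset.card_le_card hsub).trans ((Finset.card_insert_le _ _).trans ?_)
    have := Finset.card_image_le (s := Finset.Icc 1 (k - 1)) (f := n)
    rw [Nat.card_Icc] at this
    omega
  rw [ge_iff_le, div_le_iff₀ (by positivity), mul_comm]
  exact f.supNorm_le_two_pow_mul_mahlerMeasure (k - 2) hcard
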